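/- **Theorem (Characterizations of sharp solutions).** All spaces $\mathbb R^d$ are Euclidean, $\mathbb B_r(x)$ is the closed ball, and for a linear map $A$ we write $A^*$ for its adjoint and $A^\dagger$ for its Moore–Penrose inverse. For a subspace $V$, $P_V$ is the orthogonal projection onto $V$. Let $\Phi:\mathbb R^n\to\mathbb R^m$ and $D:\mathbb R^p\to\mathbb R^n$ be linear, put $D_V=D P_V$ for a subspace $V\subset\mathbb R^p$, let $J_0:\mathbb R^p\to\mathbb R$ be convex and continuous, let $J=J_0\circ D^*$, and let $x_0\in\mathbb R^n$. Consider the problem $$\min_{x\in\mathbb R^n} J(x)\quad\text{subject to}\quad \Phi x=\Phi x_0. \tag{BP$_0$}$$ Let $\Psi(x)=J(x)$ if $\Phi x=\Phi x_0$ and $\Psi(x)=+\infty$ otherwise. We say that $x_0$ is a *sharp solution of (BP$_0$) with constant* $c>0$ if there is $\varepsilon>0$ with $\Psi(x)\ge\Psi(x_0)+c\|x-x_0\|$ for all $x\in\mathbb B_\varepsilon(x_0)$, and a *sharp solution* if this holds for some $c>0$. Let $K=\partial J_0(D^*x_0)$ be the subdifferential, $e=P_{\operatorname{aff}K}(0)$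 the projection of $0$ onto its affine hull, $S=\operatorname{aff}K-e$ and $T=S^\perp$. Fix any $v_0\in\operatorname{ri}K$ (relative interior), put $C=K-v_0$, and let $\gamma_C(u)=\inf\{r>0: u\in rC\}\in[0,+\infty]$ (with $\inf\emptyset=+\infty$). Fix any linear map $N:\mathbb R^n\to\mathbb R^k$ with $\operatorname{Ker}N=\operatorname{Im}\Phi^*$ and $\operatorname{Ker}N^*=\{0\}$. The *Source Coefficient* is $$\rho(e)=\min_{u\in\operatorname{Ker}(ND_S)}\gamma_C\bigl(-(ND_S)^\dagger ND_Te-P_Sv_0+u\bigr),$$ the minimum being attained. Then the following are equivalent: 1. $x_0$ is a sharp solution of (BP$_0$). 2. *Restricted Injectivity* $\operatorname{Ker}\Phi\cap\operatorname{Ker}D_S^*=\{0\}$ holds, and $\rho(e)<1$. 3. Restricted Injectivity holds, and the *Nondegenerate Source Condition* holds: there is $v\in\operatorname{ri}\partial J_0(D^*x_0)$ with $Dv\in\operatorname{Im}\Phi^*$. Moreover, there exists $s>0$ with $\mathbb B_s(0)\cap S\subset C$. If these equivalent conditions hold and $\operatorname{Ker}\Phi\ne\{0\}$, then the minimum $$c_1=\min\{\|D_S^*w\|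 : w\in\operatorname{Ker}\Phi,\ \|w\|=1\}$$ exists and is positive, and for every $s>0$ with $\mathbb B_s(0)\cap S\subset C$ the number $c=(1-\rho(e))\,s\,c_1$ is positive and $x_0$ is a sharp solution of (BP$_0$) with constant $c$. If $\operatorname{Ker}\Phi=\{0\}$, then $x_0$ is a sharp solution of (BP$_0$) with every constant $c>0$. -/

import Mathlib

open scoped ENNReal

noncomputable section

namespace SharpRecovery

variable {V W : Type*}
  [NormedAddCommGroup V] [InnerProductSpace ℝ V]
  [NormedAddCommGroup W] [InnerProductSpace ℝ W]

/-! ### Linear algebra -/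

theorem injective_domRestrict_ker_orthogonal (A : V →ₗ[ℝ] W) :
    Function.Injective (A.domRestrict (LinearMap.ker A)ᗮ) := by
  rw [← LinearMap.ker_eq_bot, Submodule.eq_bot_iff]
  rintro ⟨x, hx⟩ h
  have h0 : x ∈ LinearMap.ker A := by simpa using h
  have h1 : inner ℝ x x = 0 := (Submodule.mem_orthogonal _ x).1 hx x h0
  exact Subtype.ext (inner_self_eq_zero.1 h1)

/-- The Moore-Penrose generalized inverse of `A`: project orthogonally onto the range of `A`, then
invert the bijection from `(Ker A)ᗮ` onto that range. -/
def pinv [FiniteDimensional ℝ V] (A : V →ₗ[ℝ] W) : W →ₗ[ℝ] V :=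
  (LinearMap.ker A)ᗮ.subtype ∘ₗ
    (LinearEquiv.ofInjective (A.domRestrict (LinearMap.ker A)ᗮ)
      (injective_domRestrict_ker_orthogonal A)).symm.toLinearMap ∘ₗ
    (LinearMap.range (A.domRestrict (LinearMap.ker A)ᗮ)).orthogonalProjectionOnto.toLinearMap

/-- The orthogonal projection onto the subspace `S`, as a linear endomorphism. -/
def proj [FiniteDimensional ℝ V] (S : Submodule ℝ V) : V →ₗ[ℝ] V := S.starProjection.toLinearMap

/-- The operator `D_S = D ∘ proj_S`. -/
def restr [FiniteDimensional ℝ V] (D : V →ₗ[ℝ] W) (S : Submodule ℝ V) : V →ₗ[ℝ] W := D ∘ₗ proj S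

/-! ### Convex analysis -/

/-- The subdifferential of a finite-valued function `f` at `x`. -/
def subdifferential (f : V → ℝ) (x : V) : Set V :=
  {v | ∀ u, f x + inner ℝ v (u - x) ≤ f u}

/-- The (extended-valued) gauge `inf {r > 0 | u ∈ r C}` of `C`, equal to `∞` if there is no
such `r`. -/
def gaugeFn (C : Set V) (u : V) : ℝ≥0∞ :=
  ⨅ (r : ℝ) (_ : 0 < r ∧ ∃ z ∈ C, u = r • z), ENNReal.ofReal r

/-- The indicator function of `C` in the sense of convex analysis. -/
def indicatorFn (C : Set V) (x : V) : EReal :=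
  open scoped Classical in if x ∈ C then 0 else ⊤

/-- `x` is a sharp minimizer of `φ` with constant `c`. -/
def IsSharpMinimizer (φ : V → EReal) (x : V) (c : ℝ) : Prop :=
  0 < c ∧ ∃ ε > (0 : ℝ), ∀ z ∈ Metric.closedBall x ε, φ x + ((c * ‖z - x‖ : ℝ) : EReal) ≤ φ z

/-- The model vector of a set `K`: the orthogonal projection of `0` onto the affine hull of `K`
(and `0`, by convention, if `K` is empty). -/
def modelVector [FiniteDimensional ℝ V] (K : Set V) : V :=
  open scoped Classical in
  if h : K.Nonempty then
    haveI : Nonempty (affineSpan ℝ K) := ((affineSpan_nonempty ℝ).2 h).to_subtype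
    ((EuclideanGeometry.orthogonalProjection (affineSpan ℝ K) 0 : affineSpan ℝ K) : V)
  else 0

/-- The linear subspace `S` parallel to the affine hull of `K`. The model tangent subspace is
its orthogonal complement. -/
def parallelSpace (K : Set V) : Submodule ℝ V := (affineSpan ℝ K).direction

theorem modelVector_mem [FiniteDimensional ℝ V] {K : Set V} (h : K.Nonempty) : modelVector K ∈ affineSpan ℝ K := by
  rw [modelVector, dif_pos h]
  exact Subtype.property _

/-- `S` is the affine hull of `K` translated by the model vector. -/
theorem coe_parallelSpace [FiniteDimensional ℝ V] {K : Set V} (h : K.Nonempty) :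
    (parallelSpace K : Set V) = (fun v => v - modelVector K) '' (affineSpan ℝ K : Set V) :=
  AffineSubspace.coe_direction_eq_vsub_set_right (modelVector_mem h)

/-! ### The recovery problem

`x₀ : ℝⁿ` is the reference vector, `Φ : ℝⁿ → ℝᵐ` the measurement operator, and the regularizer is
`J = J₀ ∘ D*` with `D : ℝᵖ → ℝⁿ`. -/

variable {n m p k : ℕ}

/-- The objective `Ψ = J + ι` of the problem of minimizing `J x` subject to `Φ x = Φ x₀`, where
`ι` is the indicator function of the set of feasible points. -/
def objective (J : EuclideanSpace ℝ (Fin n) → ℝ)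
    (Φ : EuclideanSpace ℝ (Fin n) →ₗ[ℝ] EuclideanSpace ℝ (Fin m))
    (x₀ x : EuclideanSpace ℝ (Fin n)) : EReal :=
  (J x : EReal) + indicatorFn {z | Φ z = Φ x₀} x

/-- `x₀` is a sharp solution, with constant `c`, of minimizing `J x` subject to `Φ x = Φ x₀`. -/
def IsSharpSolutionWith (J : EuclideanSpace ℝ (Fin n) → ℝ)
    (Φ : EuclideanSpace ℝ (Fin n) →ₗ[ℝ] EuclideanSpace ℝ (Fin m))
    (x₀ : EuclideanSpace ℝ (Fin n)) (c : ℝ) : Prop :=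
  IsSharpMinimizer (objective J Φ x₀) x₀ c

/-- `x₀` is a sharp solution of minimizing `J x` subject to `Φ x = Φ x₀`. -/
def IsSharpSolution (J : EuclideanSpace ℝ (Fin n) → ℝ)
    (Φ : EuclideanSpace ℝ (Fin n) →ₗ[ℝ] EuclideanSpace ℝ (Fin m))
    (x₀ : EuclideanSpace ℝ (Fin n)) : Prop :=
  ∃ c, IsSharpSolutionWith J Φ x₀ c

/-- The analysis-type regularizer `J = J₀ ∘ D*`. -/
def analysisReg (J₀ : EuclideanSpace ℝ (Fin p) → ℝ)
    (D : EuclideanSpace ℝ (Fin p) →ₗ[ℝ] EuclideanSpace ℝ (Fin n))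
    (x : EuclideanSpace ℝ (Fin n)) : ℝ :=
  J₀ (D.adjoint x)

/-- Restricted Injectivity: `Ker Φ ∩ Ker D_S* = {0}`. -/
def RestrictedInjectivity (Φ : EuclideanSpace ℝ (Fin n) →ₗ[ℝ] EuclideanSpace ℝ (Fin m))
    (D : EuclideanSpace ℝ (Fin p) →ₗ[ℝ] EuclideanSpace ℝ (Fin n))
    (S : Submodule ℝ (EuclideanSpace ℝ (Fin p))) : Prop :=
  LinearMap.ker Φ ⊓ LinearMap.ker (restr D S).adjoint = ⊥

/-- The function `u ↦ γ_C(-(N D_S)† N D_T e - proj_S v₀ + u)` that is minimized over `Ker (N D_S)`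
in the Source Coefficient, where `K` is the subdifferential of `J₀` at `D* x₀`, `e` its model
vector, `S` the subspace parallel to its affine hull, `T = Sᗮ` and `C = K - v₀`. -/
def sourceGauge (N : EuclideanSpace ℝ (Fin n) →ₗ[ℝ] EuclideanSpace ℝ (Fin k))
    (D : EuclideanSpace ℝ (Fin p) →ₗ[ℝ] EuclideanSpace ℝ (Fin n))
    (K : Set (EuclideanSpace ℝ (Fin p))) (v₀ u : EuclideanSpace ℝ (Fin p)) : ℝ≥0∞ :=
  gaugeFn ((fun v => v - v₀) '' K)
    (-(pinv (N ∘ₗ restr D (parallelSpace K))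
        (N (restr D (parallelSpace K)ᗮ (modelVector K))))
      - proj (parallelSpace K) v₀ + u)

/-- The Source Coefficient `ρ(e)`. -/
def sourceCoefficient (N : EuclideanSpace ℝ (Fin n) →ₗ[ℝ] EuclideanSpace ℝ (Fin k))
    (D : EuclideanSpace ℝ (Fin p) →ₗ[ℝ] EuclideanSpace ℝ (Fin n))
    (K : Set (EuclideanSpace ℝ (Fin p))) (v₀ : EuclideanSpace ℝ (Fin p)) : ℝ≥0∞ :=
  ⨅ u ∈ LinearMap.ker (N ∘ₗ restr D (parallelSpace K)), sourceGauge N D K v₀ u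

/-- The Nondegenerate Source Condition: `D v ∈ Im Φ*` for some `v` in the relative interior of
the subdifferential `K` of `J₀` at `D* x₀`. -/
def NondegenerateSourceCondition
    (Φ : EuclideanSpace ℝ (Fin n) →ₗ[ℝ] EuclideanSpace ℝ (Fin m))
    (D : EuclideanSpace ℝ (Fin p) →ₗ[ℝ] EuclideanSpace ℝ (Fin n))
    (K : Set (EuclideanSpace ℝ (Fin p))) : Prop :=
  ∃ v ∈ intrinsicInterior ℝ K, D v ∈ LinearMap.range Φ.adjoint

end SharpRecovery

end

/-!
For `w ∈ Ker Φ`, the directional derivative of `J` at `x₀` along `w` is the maximum of `⟨D v, w⟩`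
over `v ∈ K`, so sharpness says that this maximum dominates `c ‖w‖`. Only the hard half of the max
formula is needed (`exists_mem_subdifferential_le_inner`, by Hahn-Banach).

*Sharpness gives the source condition.* On `Ker Φ ∩ Ker D_S*` the derivative is odd in `w`, hence
cannot be bounded below by `c ‖w‖` unless `w = 0`. Separating points from the compact convex
set `P D K`, where `P` is the projection onto `Ker Φ`, shows that it contains the ball of radius `c`
of `Ker Φ` (`exists_subgradient_starProjection_eq`). Choosing `v₁ ∈ K` with
`P D v₁ = -t P D v₀` and averaging it with `v₀` gives a relatively interior `v` with `P D v = 0`, that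
is, `D v ∈ Im Φ*`.

*The Source Coefficient.* Restricted Injectivity means `Im Φ* + Im D_S` is the whole space, so
`N D_S` has the range of `N` and its generalized inverse is a genuine right inverse there. The
vectors in the argument of the gauge that lie in `S` are therefore the `η ∈ S` with
`D (v₀ + η) ∈ Im Φ*` (`apply_add_eq_zero_iff`), and `ρ(e)` is the least gauge of such an `η`. It is below
`1` if `v₀ + η` is relatively interior, since then `η` can be prolonged within `K - v₀`.

*The constant.* If `η = ρ z` with `z ∈ C` is a minimizer, then by convexity
`v₀ + η + (1 - ρ) d ∈ K` for every `d ∈ S` with `‖d‖ ≤ s`. As `⟨D (v₀ + η), w⟩ = 0` on `Ker Φ`, taking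
`d` in the direction of `D_S* w` yields `J (x₀ + w) ≥ J x₀ + (1 - ρ) s ‖D_S* w‖`
(`analysisReg_add_le_of_certificate`).
-/

namespace SharpRecovery

section General

variable {V W : Type*}
  [NormedAddCommGroup V] [InnerProductSpace ℝ V]
  [NormedAddCommGroup W] [InnerProductSpace ℝ W]

/-! ### The subdifferential -/

theorem convex_subdifferential (f : V → ℝ) (x : V) : Convex ℝ (subdifferential f x) := by
  intro v hv w hw a b ha hb hab u
  have h1 := mul_le_mul_of_nonneg_left (hv u) ha
  have h2 := mul_le_mul_of_nonneg_left (hw u) hb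
  have h3 : f x = a * f x + b * f x := by rw [← add_mul, hab, one_mul]
  have h4 : f u = a * f u + b * f u := by rw [← add_mul, hab, one_mul]
  rw [inner_add_left, real_inner_smul_left, real_inner_smul_left]
  linarith

theorem isCompact_subdifferential [FiniteDimensional ℝ V] {f : V → ℝ} (hf : Continuous f) (x : V) :
    IsCompact (subdifferential f x) := by
  have hclosed : IsClosed (subdifferential f x) := by
    have : subdifferential f x = ⋂ u, {v | f x + inner ℝ v (u - x) ≤ f u} := by
      ext v; simp [subdifferential]
    rw [this]
    exact isClosed_iInter fun u => isClosed_le (by fun_prop) continuous_const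
  obtain ⟨M, hM⟩ := (isCompact_closedBall x 1).bddAbove_image hf.continuousOn
  refine Metric.isCompact_of_isClosed_isBounded hclosed
    (isBounded_iff_forall_norm_le.2 ⟨M - f x, fun v hv => ?_⟩)
  -- test the subgradient inequality at distance one from `x`, in the direction of `v`
  have h1 := hv (x + ‖v‖⁻¹ • v)
  have hmem : x + ‖v‖⁻¹ • v ∈ Metric.closedBall x 1 := by
    rw [mem_closedBall_iff_norm, add_sub_cancel_left, norm_smul, norm_inv, norm_norm]
    exact inv_mul_le_one
  have h2 := hM ⟨_, hmem, rfl⟩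
  rw [add_sub_cancel_left, real_inner_smul_right, real_inner_self_eq_norm_mul_norm,
    ← mul_assoc, inv_mul_mul_self] at h1
  linarith

/-- The nontrivial half of the max formula: a lower bound for the directional derivative of `f`
at `x` is realized by a subgradient. The open strict epigraph of `f` is separated from the segment
with the prescribed slope. -/
theorem exists_mem_subdifferential_le_inner [FiniteDimensional ℝ V] {f : V → ℝ}
    (hconv : ConvexOn ℝ Set.univ f) (hcont : Continuous f) {x z : V} {a δ : ℝ} (hδ : 0 < δ)
    (h : ∀ t, 0 ≤ t → t ≤ δ → f x + t * a ≤ f (x + t • z)) :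
    ∃ v ∈ subdifferential f x, a ≤ inner ℝ v z := by
  set P : Set (V × ℝ) := {q | f q.1 < q.2} with hP
  set Q : Set (V × ℝ) := AffineMap.lineMap (x, f x) (x + δ • z, f x + δ * a) '' Set.Icc (0 : ℝ) 1
    with hQ
  have hPo : IsOpen P := isOpen_lt (hcont.comp continuous_fst) continuous_snd
  have hPc : Convex ℝ P := by simpa [hP] using hconv.convex_strict_epigraph
  have hQc : Convex ℝ Q := by
    rw [hQ]; exact (convex_Icc 0 1).affine_image _
  have hdisj : Disjoint P Q := by
    rw [Set.disjoint_left]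
    rintro _ hp ⟨t, ⟨ht0, ht1⟩, rfl⟩
    have h1 := h (t * δ) (by positivity) (by nlinarith)
    simp only [hP, Set.mem_ofPred_eq, AffineMap.lineMap_apply, vsub_eq_sub, vadd_eq_add,
      Prod.fst_add, Prod.smul_fst, Prod.snd_add, Prod.smul_snd, Prod.fst_sub, Prod.snd_sub,
      add_sub_cancel_left, smul_smul, smul_eq_mul] at hp
    rw [add_comm _ x] at hp
    nlinarith
  obtain ⟨F, u, hFP, hFQ⟩ := geometric_hahn_banach_open hPc hPo hQc hdisj
  set β := F (0, 1) with hβ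
  set g : V →L[ℝ] ℝ := F.comp (ContinuousLinearMap.inl ℝ V ℝ) with hg
  have hF : ∀ y r, F (y, r) = g y + r * β := fun y r => by
    have : ((y, r) : V × ℝ) = (y, 0) + r • (0, 1) := by simp
    rw [this, map_add, map_smul]; simp [hg, hβ]
  have hQ0 : u ≤ g x + f x * β := by
    rw [← hF]; exact hFQ _ ⟨0, by simp, by simp⟩
  have hQ1 : u ≤ g x + δ * g z + (f x + δ * a) * β := by
    have := hFQ _ ⟨1, by simp, AffineMap.lineMap_apply_one _ _⟩
    rwa [hF, map_add, map_smul, smul_eq_mul] at this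
  have hPy : ∀ y r, f y < r → g y + r * β < u := fun y r hr => by
    rw [← hF]; exact hFP _ hr
  have hβneg : β < 0 := by
    have := hPy x (f x + 1) (by linarith)
    nlinarith
  have hPy' : ∀ y, g y + f y * β ≤ u := fun y => by
    refine le_of_forall_pos_le_add fun η hη => ?_
    have := hPy y (f y + η / (-β))
      (lt_add_of_pos_right _ (div_pos hη (neg_pos.2 hβneg)))
    have h2 : η / (-β) * β = -η := by rw [div_neg, neg_mul, div_mul_cancel₀ _ hβneg.ne]
    nlinarith
  refine ⟨(-β)⁻¹ • (InnerProductSpace.toDual ℝ V).symm g, fun y => ?_, ?_⟩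
  · rw [real_inner_smul_left, InnerProductSpace.toDual_symm_apply, map_sub]
    have h1 := hPy' y
    have h2 : (-β)⁻¹ * (g y - g x) ≤ f y - f x := by
      rw [inv_mul_le_iff₀ (by linarith)]; nlinarith
    linarith
  · rw [real_inner_smul_left, InnerProductSpace.toDual_symm_apply, le_inv_mul_iff₀ (by linarith)]
    have h1 := hPy' x
    have : 0 ≤ δ * (g z + a * β) := by linarith
    nlinarith [nonneg_of_mul_nonneg_right this hδ]

/-! ### The gauge -/

theorem gaugeFn_le_ofReal_iff {C : Set V} (hC : IsCompact C) (hconv : Convex ℝ C)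
    (h0 : (0 : V) ∈ C) {x : V} {r : ℝ} (hr : 0 ≤ r) :
    gaugeFn C x ≤ ENNReal.ofReal r ↔ ∃ z ∈ C, x = r • z := by
  constructor
  · intro h
    -- `x` lies in `(r + t) C` for all `t > 0`, and the set of admissible `t ≥ 0` is closed
    set Q : Set (ℝ × V) := (Set.Icc (0 : ℝ) 1 ×ˢ C) ∩ {q | x = (r + q.1) • q.2} with hQ
    have hQc : IsCompact (Prod.fst '' Q) := by
      refine IsCompact.image ?_ continuous_fst
      exact (isCompact_Icc.prod hC).inter_right (isClosed_eq continuous_const (by fun_prop))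
    have hmem : ∀ t, t ∈ Set.Ioc (0 : ℝ) 1 → t ∈ Prod.fst '' Q := by
      rintro t ⟨ht, ht1⟩
      have hlt : gaugeFn C x < ENNReal.ofReal (r + t) :=
        h.trans_lt ((ENNReal.ofReal_lt_ofReal_iff (by linarith)).2 (by linarith))
      simp only [gaugeFn, iInf_lt_iff] at hlt
      obtain ⟨q, ⟨hq, z, hz, rfl⟩, hqlt⟩ := hlt
      have hqlt' := (ENNReal.ofReal_lt_ofReal_iff (by linarith)).1 hqlt
      refine ⟨(t, (q / (r + t)) • z), ⟨⟨⟨ht.le, ht1⟩, ?_⟩, ?_⟩, rfl⟩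
      · exact hconv.smul_mem_of_zero_mem h0 hz
          ⟨by positivity, (div_le_one (by linarith)).2 hqlt'.le⟩
      · simp only [Set.mem_ofPred_eq, smul_smul]
        rw [mul_div_cancel₀ _ (by linarith)]
    have h0Q : (0 : ℝ) ∈ Prod.fst '' Q := by
      have : (0 : ℝ) ∈ closure (Set.Ioc (0 : ℝ) 1) := by
        rw [closure_Ioc zero_ne_one]; simp
      exact closure_minimal hmem hQc.isClosed this
    obtain ⟨⟨t, z⟩, ⟨⟨-, hz⟩, hx⟩, rfl⟩ := h0Q
    exact ⟨z, hz, by simpa using hx⟩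
  · rintro ⟨z, hz, rfl⟩
    rcases hr.eq_or_lt with rfl | hr
    · refine ENNReal.le_of_forall_pos_le_add fun ε hε _ => ?_
      refine (iInf₂_le (ε : ℝ) ⟨by exact_mod_cast hε, 0, h0, by simp⟩).trans ?_
      simp
    · exact iInf₂_le r ⟨hr, z, hz, rfl⟩

theorem exists_gaugeFn_add_eq_iInf {C : Set V} (hC : IsCompact C) (hconv : Convex ℝ C)
    (h0 : (0 : V) ∈ C) [FiniteDimensional ℝ V] (L : Submodule ℝ V) (a : V) :
    ∃ u ∈ L, gaugeFn C (a + u) = ⨅ u ∈ L, gaugeFn C (a + u) := by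
  by_cases htop : ∀ u ∈ L, gaugeFn C (a + u) = ⊤
  · refine ⟨0, L.zero_mem, ?_⟩
    rw [htop 0 L.zero_mem, eq_comm, iInf₂_eq_top]
    exact htop
  push Not at htop
  obtain ⟨u₀, hu₀, hfin⟩ := htop
  set R := (gaugeFn C (a + u₀)).toReal with hR
  have hR0 : 0 ≤ R := ENNReal.toReal_nonneg
  -- the pairs `(r, z)` with `r z ∈ a + L` form a compact set, on which `r` has a minimum
  set Q : Set (ℝ × V) := (Set.Icc (0 : ℝ) R ×ˢ C) ∩ {q | q.1 • q.2 - a ∈ L} with hQ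
  have hQc : IsCompact Q := by
    refine (isCompact_Icc.prod hC).inter_right ?_
    exact L.closed_of_finiteDimensional.preimage (by fun_prop)
  have key : ∀ u ∈ L, gaugeFn C (a + u) ≤ ENNReal.ofReal R →
      ∃ z, ((gaugeFn C (a + u)).toReal, z) ∈ Q ∧ a + u = (gaugeFn C (a + u)).toReal • z := by
    intro u hu hle
    have hne : gaugeFn C (a + u) ≠ ⊤ := ne_top_of_le_ne_top ENNReal.ofReal_ne_top hle
    obtain ⟨z, hz, hz'⟩ := (gaugeFn_le_ofReal_iff hC hconv h0 ENNReal.toReal_nonneg).1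
      (ENNReal.ofReal_toReal hne).ge
    refine ⟨z, ⟨⟨⟨ENNReal.toReal_nonneg, ENNReal.toReal_le_of_le_ofReal hR0 hle⟩, hz⟩, ?_⟩, hz'⟩
    simpa [← hz'] using hu
  obtain ⟨z₀, hz₀, -⟩ := key u₀ hu₀ (ENNReal.ofReal_toReal hfin).ge
  obtain ⟨⟨r, z⟩, ⟨⟨⟨hr0, hrR⟩, hz⟩, hzL⟩, hmin⟩ :=
    hQc.exists_isMinOn ⟨_, hz₀⟩ continuous_fst.continuousOn
  have hle : gaugeFn C (a + (r • z - a)) ≤ ENNReal.ofReal r :=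
    (gaugeFn_le_ofReal_iff hC hconv h0 hr0).2 ⟨z, hz, by abel⟩
  refine ⟨r • z - a, hzL, le_antisymm (le_iInf₂ fun u hu => hle.trans ?_) (iInf₂_le (r • z - a) hzL)⟩
  rcases le_total (gaugeFn C (a + u)) (ENNReal.ofReal R) with h | h
  · obtain ⟨z', hz', -⟩ := key u hu h
    exact ENNReal.ofReal_le_of_le_toReal (hmin hz')
  · exact (ENNReal.ofReal_le_ofReal hrR).trans h

/-! ### Affine hull and relative interior -/

theorem sub_mem_parallelSpace {K : Set V} {v w : V} (hv : v ∈ K) (hw : w ∈ K) :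
    v - w ∈ parallelSpace K :=
  AffineSubspace.vsub_mem_direction (subset_affineSpan ℝ K hv) (subset_affineSpan ℝ K hw)

/-- Relatively interior points are those around which `K` contains a ball of its affine hull. -/
theorem mem_intrinsicInterior_iff_exists_ball {K : Set V} {v : V} :
    v ∈ intrinsicInterior ℝ K ↔ ∃ s > 0, ∀ d ∈ parallelSpace K, ‖d‖ ≤ s → v + d ∈ K := by
  rw [mem_intrinsicInterior]
  constructor
  · rintro ⟨y, hy, rfl⟩
    obtain ⟨s, hs, hball⟩ := Metric.nhds_basis_closedBall.mem_iff.1 (mem_interior_iff_mem_nhds.1 hy)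
    refine ⟨s, hs, fun d hd hds => ?_⟩
    have hm : (y : V) + d ∈ affineSpan ℝ K := by
      rw [add_comm]; exact AffineSubspace.vadd_mem_of_mem_direction hd y.2
    have : (⟨y + d, hm⟩ : affineSpan ℝ K) ∈ Metric.closedBall y s := by
      rw [Metric.mem_closedBall, Subtype.dist_eq]
      simpa [dist_eq_norm] using hds
    exact hball this
  · rintro ⟨s, hs, h⟩
    have hv : v ∈ K := by simpa using h 0 (Submodule.zero_mem _) (by simpa using hs.le)
    refine ⟨⟨v, subset_affineSpan ℝ K hv⟩, ?_, rfl⟩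
    refine mem_interior_iff_mem_nhds.2 (Metric.nhds_basis_closedBall.mem_iff.2 ⟨s, hs, ?_⟩)
    intro y hy
    rw [Metric.mem_closedBall, Subtype.dist_eq, dist_eq_norm] at hy
    have := h (y - v) (AffineSubspace.vsub_mem_direction y.2 (subset_affineSpan ℝ K hv)) hy
    simpa using this

theorem modelVector_mem_orthogonal [FiniteDimensional ℝ V] {K : Set V} (h : K.Nonempty) :
    modelVector K ∈ (parallelSpace K)ᗮ := by
  have : Nonempty (affineSpan ℝ K) := ((affineSpan_nonempty ℝ).2 h).to_subtype
  rw [modelVector, dif_pos h]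
  simpa [parallelSpace] using
    EuclideanGeometry.orthogonalProjection_vsub_mem_direction_orthogonal (affineSpan ℝ K) (0 : V)

theorem sub_modelVector_mem [FiniteDimensional ℝ V] {K : Set V} {v : V} (hv : v ∈ K) :
    v - modelVector K ∈ parallelSpace K :=
  AffineSubspace.vsub_mem_direction (subset_affineSpan ℝ K hv) (modelVector_mem ⟨v, hv⟩)

theorem proj_of_mem [FiniteDimensional ℝ V] {S : Submodule ℝ V} {v : V} (hv : v ∈ S) :
    proj S v = v :=
  Submodule.starProjection_eq_self_iff.2 hv

theorem proj_parallelSpace [FiniteDimensional ℝ V] {K : Set V} {v : V} (hv : v ∈ K) :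
    proj (parallelSpace K) v = v - modelVector K := by
  have h : proj (parallelSpace K) (modelVector K) = 0 :=
    (Submodule.starProjection_apply_eq_zero_iff _).2 (modelVector_mem_orthogonal ⟨v, hv⟩)
  rw [← proj_of_mem (sub_modelVector_mem hv), map_sub, h, sub_zero]

/-! ### Generalized inverse and restricted operators -/

theorem apply_pinv_of_mem_range [FiniteDimensional ℝ V] (A : V →ₗ[ℝ] W) {y : W}
    (hy : y ∈ LinearMap.range A) : A (pinv A y) = y := by
  obtain ⟨x, rfl⟩ := hy
  set U := LinearMap.range (A.domRestrict (LinearMap.ker A)ᗮ) with hU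
  have hx : A x ∈ U := by
    refine ⟨⟨(LinearMap.ker A)ᗮ.starProjection x, Submodule.starProjection_apply_mem _ x⟩, ?_⟩
    have h1 : A ((LinearMap.ker A).starProjection x) = 0 :=
      Submodule.starProjection_apply_mem (LinearMap.ker A) x
    conv_rhs => rw [← Submodule.starProjection_add_starProjection_orthogonal
      (K := LinearMap.ker A) x, map_add, h1, zero_add]
    rfl
  have h2 : U.orthogonalProjectionOnto (A x) = ⟨A x, hx⟩ :=
    Submodule.orthogonalProjectionOnto_mem_subspace_eq_self (⟨A x, hx⟩ : U)
  have h3 := (LinearEquiv.ofInjective (A.domRestrict (LinearMap.ker A)ᗮ)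
      (injective_domRestrict_ker_orthogonal A)).apply_symm_apply ⟨A x, hx⟩
  have h4 := congrArg Subtype.val h3
  rw [LinearEquiv.ofInjective_apply, LinearMap.domRestrict_apply] at h4
  simp only [pinv, LinearMap.comp_apply, Submodule.subtype_apply]
  erw [h2]
  exact h4

theorem restr_of_mem [FiniteDimensional ℝ V] (D : V →ₗ[ℝ] W) {S : Submodule ℝ V} {v : V}
    (hv : v ∈ S) : restr D S v = D v := by
  rw [restr, LinearMap.comp_apply, proj_of_mem hv]

theorem adjoint_restr_apply [FiniteDimensional ℝ V] [FiniteDimensional ℝ W] (D : V →ₗ[ℝ] W)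
    (S : Submodule ℝ V) (w : W) :
    (restr D S).adjoint w = proj S (D.adjoint w) := by
  refine ext_inner_right ℝ fun v => ?_
  rw [LinearMap.adjoint_inner_left, restr, LinearMap.comp_apply, ← LinearMap.adjoint_inner_left]
  exact (Submodule.inner_starProjection_left_eq_right S _ _).symm

end General

section Recovery

variable {n m p k : ℕ}
  {Φ : EuclideanSpace ℝ (Fin n) →ₗ[ℝ] EuclideanSpace ℝ (Fin m)}
  {D : EuclideanSpace ℝ (Fin p) →ₗ[ℝ] EuclideanSpace ℝ (Fin n)}
  {J₀ : EuclideanSpace ℝ (Fin p) → ℝ}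
  {N : EuclideanSpace ℝ (Fin n) →ₗ[ℝ] EuclideanSpace ℝ (Fin k)}
  {x₀ : EuclideanSpace ℝ (Fin n)} {K : Set (EuclideanSpace ℝ (Fin p))}

/-! ### Sharp solutions -/

theorem isSharpSolutionWith_iff {J : EuclideanSpace ℝ (Fin n) → ℝ} {c : ℝ} :
    IsSharpSolutionWith J Φ x₀ c ↔
      0 < c ∧ ∃ ε > 0, ∀ w ∈ LinearMap.ker Φ, ‖w‖ ≤ ε → J x₀ + c * ‖w‖ ≤ J (x₀ + w) := by
  refine and_congr_right fun _ => exists_congr fun ε => and_congr_right fun _ => ?_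
  constructor
  · intro h w hw hwε
    have := h (x₀ + w) (by simpa [mem_closedBall_iff_norm] using hwε)
    rw [LinearMap.mem_ker] at hw
    simp only [objective, indicatorFn, Set.mem_ofPred_eq, map_add, hw, add_zero, if_true,
      add_sub_cancel_left] at this
    exact_mod_cast this
  · intro h z hz
    by_cases hzΦ : Φ z = Φ x₀
    · have := h (z - x₀) (by rw [LinearMap.mem_ker, map_sub, hzΦ, sub_self])
        (mem_closedBall_iff_norm.1 hz)
      simp only [objective, indicatorFn, Set.mem_ofPred_eq, hzΦ, if_true, add_zero]
      rw [add_sub_cancel] at this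
      exact_mod_cast this
    · simp [objective, indicatorFn, hzΦ]

theorem isSharpSolutionWith_of_ker_eq_bot (J : EuclideanSpace ℝ (Fin n) → ℝ)
    (hΦ : LinearMap.ker Φ = ⊥) {c : ℝ} (hc : 0 < c) : IsSharpSolutionWith J Φ x₀ c := by
  refine isSharpSolutionWith_iff.2 ⟨hc, 1, one_pos, fun w hw _ => ?_⟩
  rw [hΦ, Submodule.mem_bot] at hw
  simp [hw]

/-- At a sharp solution, every direction `w` in `Ker Φ` is supported by a subgradient. -/
theorem exists_subgradient_of_isSharpSolutionWith (hconv : ConvexOn ℝ Set.univ J₀)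
    (hcont : Continuous J₀) {c : ℝ} (h : IsSharpSolutionWith (analysisReg J₀ D) Φ x₀ c)
    {w : EuclideanSpace ℝ (Fin n)} (hw : w ∈ LinearMap.ker Φ) :
    ∃ v ∈ subdifferential J₀ (D.adjoint x₀), c * ‖w‖ ≤ inner ℝ (D v) w := by
  obtain ⟨hc, ε, hε, h⟩ := isSharpSolutionWith_iff.1 h
  obtain ⟨v, hv, hvw⟩ := exists_mem_subdifferential_le_inner hconv hcont
    (x := D.adjoint x₀) (z := D.adjoint w) (a := c * ‖w‖) (δ := ε / (‖w‖ + 1)) (by positivity)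
    (fun t ht0 ht => by
      have h1 := h (t • w) (Submodule.smul_mem _ _ hw) (by
        rw [le_div_iff₀ (by positivity)] at ht
        rw [norm_smul, Real.norm_of_nonneg ht0]
        linarith)
      rw [norm_smul, Real.norm_of_nonneg ht0] at h1
      simp only [analysisReg, map_add, map_smul] at h1
      linarith)
  exact ⟨v, hv, by rwa [LinearMap.adjoint_inner_right] at hvw⟩

/-- Opposite directions `±w` in `Ker Φ ∩ Ker D_S*` have opposite directional derivatives, because
on the affine hull of `K` the functional `⟨D ·, w⟩` is constant. -/
theorem restrictedInjectivity_of_isSharpSolutionWith (hconv : ConvexOn ℝ Set.univ J₀)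
    (hcont : Continuous J₀) {c : ℝ} (h : IsSharpSolutionWith (analysisReg J₀ D) Φ x₀ c) :
    RestrictedInjectivity Φ D (parallelSpace (subdifferential J₀ (D.adjoint x₀))) := by
  rw [RestrictedInjectivity, Submodule.eq_bot_iff]
  rintro w ⟨hw, hwS⟩
  replace hwS := (adjoint_restr_apply D _ w).symm.trans hwS
  obtain ⟨v₁, hv₁, h₁⟩ := exists_subgradient_of_isSharpSolutionWith hconv hcont h hw
  obtain ⟨v₂, hv₂, h₂⟩ := exists_subgradient_of_isSharpSolutionWith hconv hcont h
    (Submodule.neg_mem _ hw)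
  have h3 : inner ℝ (D v₁ - D v₂) w = 0 := by
    rw [← map_sub, ← LinearMap.adjoint_inner_right]
    exact (Submodule.starProjection_apply_eq_zero_iff _).1 hwS _ (sub_mem_parallelSpace hv₁ hv₂)
  rw [inner_sub_left] at h3
  rw [inner_neg_right, norm_neg] at h₂
  have h4 : c * ‖w‖ ≤ 0 := by linarith
  exact norm_le_zero_iff.1 (nonpos_of_mul_nonpos_right h4 h.1)

/-- At a sharp solution, the projection of `D K` onto `Ker Φ` contains a ball around `0`. -/
theorem exists_subgradient_starProjection_eq (hconv : ConvexOn ℝ Set.univ J₀)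
    (hcont : Continuous J₀) {c : ℝ} (h : IsSharpSolutionWith (analysisReg J₀ D) Φ x₀ c)
    {b : EuclideanSpace ℝ (Fin n)} (hb : b ∈ LinearMap.ker Φ) (hbc : ‖b‖ ≤ c) :
    ∃ v ∈ subdifferential J₀ (D.adjoint x₀), (LinearMap.ker Φ).starProjection (D v) = b := by
  set P := (LinearMap.ker Φ).starProjection with hP
  set A : EuclideanSpace ℝ (Fin p) →ₗ[ℝ] EuclideanSpace ℝ (Fin n) := P.toLinearMap ∘ₗ D with hA
  set K := subdifferential J₀ (D.adjoint x₀) with hK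
  by_contra hne
  have hbA : b ∉ A '' K := fun ⟨v, hv, hvb⟩ => hne ⟨v, hv, hvb⟩
  obtain ⟨F, u, hF, hFb⟩ := geometric_hahn_banach_closed_point
    ((convex_subdifferential J₀ _).linear_image A)
    ((isCompact_subdifferential hcont _).image A.continuous_of_finiteDimensional).isClosed hbA
  set y := (InnerProductSpace.toDual ℝ _).symm F with hy
  have hFy : ∀ z, F z = inner ℝ y z := fun z =>
    (InnerProductSpace.toDual_symm_apply (𝕜 := ℝ) (x := z) (y := F)).symm
  obtain ⟨v, hv, hvw⟩ := exists_subgradient_of_isSharpSolutionWith hconv hcont h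
    (w := P y) (Submodule.starProjection_apply_mem _ _)
  have h1 : F (A v) = inner ℝ (D v) (P y) := by
    rw [hFy, real_inner_comm]
    exact Submodule.inner_starProjection_left_eq_right _ _ _
  have h2 : F b ≤ c * ‖P y‖ := by
    rw [hFy, ← Submodule.starProjection_eq_self_iff.2 hb,
      ← Submodule.inner_starProjection_left_eq_right]
    refine (real_inner_le_norm _ _).trans ?_
    rw [mul_comm]
    exact mul_le_mul_of_nonneg_right hbc (norm_nonneg _)
  have h3 := hF _ ⟨v, hv, rfl⟩
  linarith

theorem mem_range_adjoint_iff {y : EuclideanSpace ℝ (Fin n)} :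
    y ∈ LinearMap.range Φ.adjoint ↔ (LinearMap.ker Φ).starProjection y = 0 := by
  rw [Submodule.starProjection_apply_eq_zero_iff, LinearMap.orthogonal_ker]

theorem nondegenerateSourceCondition_of_isSharpSolutionWith (hconv : ConvexOn ℝ Set.univ J₀)
    (hcont : Continuous J₀) {c : ℝ} (h : IsSharpSolutionWith (analysisReg J₀ D) Φ x₀ c)
    {v₀ : EuclideanSpace ℝ (Fin p)}
    (hv₀ : v₀ ∈ intrinsicInterior ℝ (subdifferential J₀ (D.adjoint x₀))) :
    NondegenerateSourceCondition Φ D (subdifferential J₀ (D.adjoint x₀)) := by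
  set K := subdifferential J₀ (D.adjoint x₀) with hK
  set P := (LinearMap.ker Φ).starProjection with hP
  obtain ⟨s, hs, hball⟩ := mem_intrinsicInterior_iff_exists_ball.1 hv₀
  -- if `v₁ ∈ K` satisfies `P D v₁ = -t P D v₀`, then `(v₁ + t v₀) / (1 + t)` is the required
  -- certificate; it is relatively interior because `v₀` is
  have hc := h.1
  set t := c / (‖P (D v₀)‖ + 1) with ht
  have htpos : 0 < t := by positivity
  obtain ⟨v₁, hv₁, hPv₁⟩ := exists_subgradient_starProjection_eq hconv hcont h
    (b := -(t • P (D v₀)))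
    (Submodule.neg_mem _ (Submodule.smul_mem _ _ (Submodule.starProjection_apply_mem _ _)))
    (by
      rw [norm_neg, norm_smul, Real.norm_of_nonneg htpos.le, ht, div_mul_eq_mul_div,
        div_le_iff₀ (by positivity)]
      nlinarith [norm_nonneg (P (D v₀))])
  refine ⟨(1 + t)⁻¹ • (v₁ + t • v₀), mem_intrinsicInterior_iff_exists_ball.2
    ⟨s * (t / (1 + t)), by positivity, fun d hd hds => ?_⟩, ?_⟩
  · have h1 : v₀ + ((1 + t) / t) • d ∈ K := by
      refine hball _ (Submodule.smul_mem _ _ hd) ?_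
      rw [norm_smul, Real.norm_of_nonneg (by positivity)]
      calc (1 + t) / t * ‖d‖ ≤ (1 + t) / t * (s * (t / (1 + t))) := by gcongr
        _ = s := by field_simp
    have h2 := convex_subdifferential J₀ (D.adjoint x₀) hv₁ h1
      (a := (1 + t)⁻¹) (b := t * (1 + t)⁻¹) (by positivity) (by positivity) (by field_simp)
    convert h2 using 1
    have h3 : t * (1 + t)⁻¹ * ((1 + t) / t) = 1 := by field_simp
    rw [smul_add (t * (1 + t)⁻¹), smul_smul _ _ d, h3, one_smul, smul_add, smul_smul,
      mul_comm t, add_assoc]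
  · rw [mem_range_adjoint_iff, map_smul, map_smul, map_add, map_add, map_smul, map_smul]
    rw [hPv₁, neg_add_cancel, smul_zero]

/-! ### Source conditions -/

theorem range_comp_restr_of_restrictedInjectivity {S : Submodule ℝ (EuclideanSpace ℝ (Fin p))}
    (hRI : RestrictedInjectivity Φ D S) (hN : LinearMap.ker N = LinearMap.range Φ.adjoint)
    (y : EuclideanSpace ℝ (Fin n)) : N y ∈ LinearMap.range (N ∘ₗ restr D S) := by
  have htop : LinearMap.range Φ.adjoint ⊔ LinearMap.range (restr D S) = ⊤ := by
    rw [← Submodule.orthogonal_eq_bot_iff, ← Submodule.inf_orthogonal, LinearMap.orthogonal_range,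
      LinearMap.orthogonal_range, LinearMap.adjoint_adjoint]
    exact hRI
  obtain ⟨a, ha, _, ⟨b, rfl⟩, rfl⟩ := Submodule.mem_sup.1 (htop ▸ Submodule.mem_top (x := y))
  rw [← hN, LinearMap.mem_ker] at ha
  exact ⟨b, by simp [ha]⟩

/-- If `η ∈ S` is the argument of the gauge in the Source Coefficient for the variable `u`, then `u`
is admissible exactly when `D (v₀ + η)` lies in `Ker N`. This turns admissible `u` into dual
certificates in the affine hull of `K` and back. -/
theorem apply_add_eq_zero_iff {v₀ : EuclideanSpace ℝ (Fin p)} (hv₀ : v₀ ∈ K)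
    (hRI : RestrictedInjectivity Φ D (parallelSpace K))
    (hN : LinearMap.ker N = LinearMap.range Φ.adjoint) {u η : EuclideanSpace ℝ (Fin p)}
    (hη : η ∈ parallelSpace K)
    (h : η = -(pinv (N ∘ₗ restr D (parallelSpace K))
        (N (restr D (parallelSpace K)ᗮ (modelVector K)))) - proj (parallelSpace K) v₀ + u) :
    N (D (v₀ + η)) = 0 ↔ u ∈ LinearMap.ker (N ∘ₗ restr D (parallelSpace K)) := by
  have h1 := apply_pinv_of_mem_range _ (range_comp_restr_of_restrictedInjectivity hRI hN
    (restr D (parallelSpace K)ᗮ (modelVector K)))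
  have h2 := congrArg (N ∘ₗ restr D (parallelSpace K)) h
  have h3 : N (restr D (parallelSpace K) (proj (parallelSpace K) v₀)) =
      N (D v₀) - N (D (modelVector K)) := by
    rw [proj_parallelSpace hv₀, restr_of_mem D (sub_modelVector_mem hv₀), map_sub, map_sub]
  rw [map_add, map_sub, map_neg, h1, restr_of_mem D (modelVector_mem_orthogonal ⟨v₀, hv₀⟩),
    LinearMap.comp_apply, LinearMap.comp_apply, h3, restr_of_mem D hη] at h2
  rw [LinearMap.mem_ker, map_add, map_add, h2]
  constructor <;> intro h4
  · rw [← h4]; abel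
  · rw [h4]; abel

section

variable {v₀ : EuclideanSpace ℝ (Fin p)}

theorem exists_sourceGauge_eq (hKc : IsCompact K) (hKconv : Convex ℝ K) (hv₀ : v₀ ∈ K) :
    ∃ u ∈ LinearMap.ker (N ∘ₗ restr D (parallelSpace K)),
      sourceGauge N D K v₀ u = sourceCoefficient N D K v₀ := by
  refine exists_gaugeFn_add_eq_iInf (hKc.image (by fun_prop)) ?_ ⟨v₀, hv₀, by simp⟩ _ _
  simpa [sub_eq_add_neg, add_comm] using hKconv.translate (-v₀)

theorem gaugeFn_translate_le_iff (hKc : IsCompact K) (hKconv : Convex ℝ K) (hv₀ : v₀ ∈ K)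
    {η : EuclideanSpace ℝ (Fin p)} {r : ℝ} (hr : 0 ≤ r) :
    gaugeFn ((fun v => v - v₀) '' K) η ≤ ENNReal.ofReal r ↔ ∃ v ∈ K, η = r • (v - v₀) := by
  rw [gaugeFn_le_ofReal_iff (hKc.image (by fun_prop)) _ ⟨v₀, hv₀, by simp⟩ hr]
  · simp
  · simpa [sub_eq_add_neg, add_comm] using hKconv.translate (-v₀)

/-! ### Dual certificates and the growth constant -/

/-- A minimizer in the Source Coefficient yields a dual certificate. -/
theorem exists_certificate_of_sourceCoefficient_lt_one (hKc : IsCompact K) (hKconv : Convex ℝ K)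
    (hv₀ : v₀ ∈ K) (hRI : RestrictedInjectivity Φ D (parallelSpace K))
    (hN : LinearMap.ker N = LinearMap.range Φ.adjoint) (hρ : sourceCoefficient N D K v₀ < 1) :
    ∃ v ∈ K, D (v₀ + (sourceCoefficient N D K v₀).toReal • (v - v₀)) ∈
      LinearMap.range Φ.adjoint := by
  obtain ⟨u, hu, hgu⟩ := exists_sourceGauge_eq (N := N) (D := D) hKc hKconv hv₀
  obtain ⟨v, hv, hvη⟩ := (gaugeFn_translate_le_iff hKc hKconv hv₀ ENNReal.toReal_nonneg).1
    (hgu.trans (ENNReal.ofReal_toReal hρ.ne_top).symm).le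
  refine ⟨v, hv, ?_⟩
  rw [← hN, LinearMap.mem_ker]
  exact (apply_add_eq_zero_iff hv₀ hRI hN
    (Submodule.smul_mem _ _ (sub_mem_parallelSpace hv hv₀)) hvη.symm).2 hu

theorem sourceCoefficient_lt_one (hKc : IsCompact K) (hKconv : Convex ℝ K)
    (hv₀ : v₀ ∈ K) (hRI : RestrictedInjectivity Φ D (parallelSpace K))
    (hN : LinearMap.ker N = LinearMap.range Φ.adjoint)
    (h : NondegenerateSourceCondition Φ D K) : sourceCoefficient N D K v₀ < 1 := by
  obtain ⟨v, hv, hDv⟩ := h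
  obtain ⟨s, hs, hball⟩ := mem_intrinsicInterior_iff_exists_ball.1 hv
  have hvK := intrinsicInterior_subset hv
  have hS := sub_mem_parallelSpace hvK hv₀
  -- `v` can be moved away from `v₀` inside `K`, so `v - v₀` lies in `(1 + δ)⁻¹ C`
  set δ := s / (‖v - v₀‖ + 1) with hδ
  have hδpos : 0 < δ := by positivity
  have h1 : v + δ • (v - v₀) ∈ K := hball _ (Submodule.smul_mem _ _ hS) (by
    rw [norm_smul, Real.norm_of_nonneg hδpos.le, hδ, div_mul_eq_mul_div,
      div_le_iff₀ (by positivity)]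
    nlinarith [norm_nonneg (v - v₀)])
  have h2 : gaugeFn ((fun v => v - v₀) '' K) (v - v₀) ≤ ENNReal.ofReal (1 + δ)⁻¹ := by
    refine (gaugeFn_translate_le_iff hKc hKconv hv₀ (by positivity)).2 ⟨_, h1, ?_⟩
    rw [add_sub_right_comm, eq_inv_smul_iff₀ (by positivity), add_smul, one_smul]
  have h3 : ENNReal.ofReal (1 + δ)⁻¹ < 1 := by
    rw [ENNReal.ofReal_lt_one]
    exact inv_lt_one_of_one_lt₀ (by linarith)
  refine (le_trans ?_ h2).trans_lt h3
  set a := -(pinv (N ∘ₗ restr D (parallelSpace K))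
        (N (restr D (parallelSpace K)ᗮ (modelVector K)))) - proj (parallelSpace K) v₀ with ha
  have h4 : v - v₀ = a + (v - v₀ - a) := by abel
  have hu := (apply_add_eq_zero_iff hv₀ hRI hN hS h4).1 (by
    rw [add_sub_cancel]; rwa [← hN] at hDv)
  refine (iInf₂_le _ hu).trans (le_of_eq ?_)
  rw [sourceGauge, ← ha, ← h4]

/-- A certificate `v₀ + r (v - v₀)` leaves room `(1 - r) s` in every direction of `S`, which
bounds the growth of the objective from below along `Ker Φ`. -/
theorem analysisReg_add_le_of_certificate
    {v : EuclideanSpace ℝ (Fin p)} (hv : v ∈ subdifferential J₀ (D.adjoint x₀)) {r s : ℝ}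
    (hr0 : 0 ≤ r) (hr1 : r ≤ 1) (hs : 0 ≤ s)
    (hsC : Metric.closedBall 0 s ∩
        (parallelSpace (subdifferential J₀ (D.adjoint x₀)) : Set (EuclideanSpace ℝ (Fin p))) ⊆
      (fun v => v - v₀) '' subdifferential J₀ (D.adjoint x₀))
    (hD : D (v₀ + r • (v - v₀)) ∈ LinearMap.range Φ.adjoint)
    {w : EuclideanSpace ℝ (Fin n)} (hw : w ∈ LinearMap.ker Φ) :
    analysisReg J₀ D x₀ + (1 - r) * s *
        ‖(restr D (parallelSpace (subdifferential J₀ (D.adjoint x₀)))).adjoint w‖ ≤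
      analysisReg J₀ D (x₀ + w) := by
  set K := subdifferential J₀ (D.adjoint x₀) with hK
  set S := parallelSpace K with hS
  rw [adjoint_restr_apply]
  set q := proj S (D.adjoint w) with hq
  have hqS : q ∈ S := Submodule.starProjection_apply_mem _ _
  -- the subgradient obtained from the certificate by the step `(1 - r) s` in the direction of `q`
  set d := (s * ‖q‖⁻¹) • q with hd
  have hdn : ‖d‖ ≤ s := by
    rw [hd, norm_smul, Real.norm_of_nonneg (by positivity), mul_assoc]
    exact mul_le_of_le_one_right hs inv_mul_le_one
  obtain ⟨v', hv', hv'd⟩ := hsC ⟨by simpa using hdn, Submodule.smul_mem _ _ hqS⟩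
  simp only at hv'd
  have hmem := convex_subdifferential J₀ (D.adjoint x₀) hv hv' hr0 (sub_nonneg.2 hr1)
    (add_sub_cancel r 1)
  have h1 : r • v + (1 - r) • v' = (v₀ + r • (v - v₀)) + (1 - r) • d := by
    rw [hd, ← hv'd]; module
  have h2 := hmem (D.adjoint (x₀ + w))
  have h3 : inner ℝ (v₀ + r • (v - v₀)) (D.adjoint w) = 0 := by
    obtain ⟨y, hy⟩ := hD
    rw [LinearMap.adjoint_inner_right, ← hy, LinearMap.adjoint_inner_left, LinearMap.mem_ker.1 hw,
      inner_zero_right]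
  have h4 : inner ℝ d (D.adjoint w) = s * ‖q‖ := by
    have : inner ℝ q (D.adjoint w) = ‖q‖ * ‖q‖ := by
      rw [← real_inner_self_eq_norm_mul_norm]
      conv_lhs => rw [← proj_of_mem hqS]
      exact Submodule.inner_starProjection_left_eq_right S _ _
    rw [hd, real_inner_smul_left, this, mul_assoc, ← mul_assoc ‖q‖⁻¹, inv_mul_mul_self]
  rw [h1, map_add, add_sub_cancel_left, inner_add_left, h3, zero_add, real_inner_smul_left, h4,
    ← map_add] at h2
  simp only [analysisReg]
  linarith

end

theorem exists_isLeast_norm_adjoint {S : Submodule ℝ (EuclideanSpace ℝ (Fin p))}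
    (hRI : RestrictedInjectivity Φ D S) (hΦ : LinearMap.ker Φ ≠ ⊥) :
    ∃ c₁ : ℝ, IsLeast {r | ∃ w ∈ LinearMap.ker Φ, ‖w‖ = 1 ∧ r = ‖(restr D S).adjoint w‖} c₁ ∧
      0 < c₁ := by
  obtain ⟨w₀, hw₀, hne⟩ := Submodule.exists_mem_ne_zero_of_ne_bot hΦ
  have hcomp : IsCompact ((LinearMap.ker Φ : Set (EuclideanSpace ℝ (Fin n))) ∩
      Metric.sphere 0 1) :=
    (isCompact_sphere 0 1).inter_left (LinearMap.ker Φ).closed_of_finiteDimensional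
  obtain ⟨w, ⟨hw, hw1⟩, hmin⟩ := hcomp.exists_isMinOn
    ⟨‖w₀‖⁻¹ • w₀, Submodule.smul_mem _ _ hw₀, by simp [norm_smul, hne]⟩
    (f := fun w => ‖(restr D S).adjoint w‖)
    (LinearMap.continuous_of_finiteDimensional _).norm.continuousOn
  have hw1' : ‖w‖ = 1 := by simpa using hw1
  refine ⟨_, ⟨⟨w, hw, hw1', rfl⟩, ?_⟩, norm_pos_iff.2 fun h0 => ?_⟩
  · rintro _ ⟨z, hz, hz1, rfl⟩
    exact hmin ⟨hz, by simpa using hz1⟩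
  · have : w ∈ LinearMap.ker Φ ⊓ LinearMap.ker (restr D S).adjoint := ⟨hw, h0⟩
    rw [hRI, Submodule.mem_bot] at this
    simp [this] at hw1'

theorem isSharpSolutionWith_of_sourceCoefficient_lt_one
    {v₀ : EuclideanSpace ℝ (Fin p)} (hcont : Continuous J₀)
    (hK : K = subdifferential J₀ (D.adjoint x₀)) (hv₀ : v₀ ∈ K)
    (hRI : RestrictedInjectivity Φ D (parallelSpace K))
    (hN : LinearMap.ker N = LinearMap.range Φ.adjoint) (hρ : sourceCoefficient N D K v₀ < 1)
    {c₁ : ℝ} (hc₁ : IsLeast {r | ∃ w ∈ LinearMap.ker Φ, ‖w‖ = 1 ∧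
      r = ‖(restr D (parallelSpace K)).adjoint w‖} c₁) (hc₁pos : 0 < c₁) {s : ℝ} (hs : 0 < s)
    (hsC : Metric.closedBall 0 s ∩ (parallelSpace K : Set (EuclideanSpace ℝ (Fin p))) ⊆
      (fun v => v - v₀) '' K) :
    IsSharpSolutionWith (analysisReg J₀ D) Φ x₀
      ((1 - (sourceCoefficient N D K v₀).toReal) * s * c₁) := by
  have hr : (sourceCoefficient N D K v₀).toReal < 1 := by
    simpa using (ENNReal.toReal_lt_toReal hρ.ne_top ENNReal.one_ne_top).2 hρ
  have hr' := sub_pos.2 hr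
  subst hK
  obtain ⟨v, hv, hDv⟩ := exists_certificate_of_sourceCoefficient_lt_one
    (isCompact_subdifferential hcont _) (convex_subdifferential _ _) hv₀ hRI hN hρ
  refine isSharpSolutionWith_iff.2 ⟨by positivity, 1, one_pos, fun w hw _ => ?_⟩
  refine le_trans ?_ (analysisReg_add_le_of_certificate hv ENNReal.toReal_nonneg hr.le hs.le
    hsC hDv hw)
  rw [mul_assoc _ c₁]
  gcongr
  rcases eq_or_ne w 0 with rfl | hne
  · simp
  have := hc₁.2 ⟨‖w‖⁻¹ • w, Submodule.smul_mem _ _ hw, by simp [norm_smul, hne], rfl⟩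
  rw [map_smul, norm_smul, norm_inv, norm_norm, inv_mul_eq_div,
    le_div_iff₀ (norm_pos_iff.2 hne)] at this
  exact this

end Recovery

end SharpRecovery

/-! ### Characterizations of sharp solutions -/

theorem theorem4p6 {n m p k : ℕ}
    (Φ : EuclideanSpace ℝ (Fin n) →ₗ[ℝ] EuclideanSpace ℝ (Fin m))
    (D : EuclideanSpace ℝ (Fin p) →ₗ[ℝ] EuclideanSpace ℝ (Fin n))
    (J₀ : EuclideanSpace ℝ (Fin p) → ℝ)
    (hconv : ConvexOn ℝ Set.univ J₀) (hcont : Continuous J₀)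
    (x₀ : EuclideanSpace ℝ (Fin n))
    (K : Set (EuclideanSpace ℝ (Fin p)))
    (hK : K = SharpRecovery.subdifferential J₀ (D.adjoint x₀))
    (S : Submodule ℝ (EuclideanSpace ℝ (Fin p))) (hS : S = SharpRecovery.parallelSpace K)
    (v₀ : EuclideanSpace ℝ (Fin p)) (hv₀ : v₀ ∈ intrinsicInterior ℝ K)
    (N : EuclideanSpace ℝ (Fin n) →ₗ[ℝ] EuclideanSpace ℝ (Fin k))
    (hN : LinearMap.ker N = LinearMap.range Φ.adjoint) (hN' : LinearMap.ker N.adjoint = ⊥) :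
    -- the minimum that defines the Source Coefficient is attained
    (∃ u ∈ LinearMap.ker (N ∘ₗ SharpRecovery.restr D S),
      SharpRecovery.sourceGauge N D K v₀ u = SharpRecovery.sourceCoefficient N D K v₀) ∧
    -- the three equivalent conditions
    List.TFAE [
      SharpRecovery.IsSharpSolution (SharpRecovery.analysisReg J₀ D) Φ x₀,
      SharpRecovery.RestrictedInjectivity Φ D S ∧ SharpRecovery.sourceCoefficient N D K v₀ < 1,
      SharpRecovery.RestrictedInjectivity Φ D S ∧
        SharpRecovery.NondegenerateSourceCondition Φ D K] ∧
    -- admissible radii `s` exist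
    (∃ s > (0 : ℝ), Metric.closedBall 0 s ∩ (S : Set (EuclideanSpace ℝ (Fin p))) ⊆
      (fun v => v - v₀) '' K) ∧
    -- the sharpness constant
    (SharpRecovery.IsSharpSolution (SharpRecovery.analysisReg J₀ D) Φ x₀ →
      LinearMap.ker Φ ≠ ⊥ →
      ∃ c₁ : ℝ,
        IsLeast {r | ∃ w ∈ LinearMap.ker Φ, ‖w‖ = 1 ∧
          r = ‖(SharpRecovery.restr D S).adjoint w‖} c₁ ∧
        0 < c₁ ∧
        ∀ s > (0 : ℝ), Metric.closedBall 0 s ∩ (S : Set (EuclideanSpace ℝ (Fin p))) ⊆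
            (fun v => v - v₀) '' K →
          0 < (1 - (SharpRecovery.sourceCoefficient N D K v₀).toReal) * s * c₁ ∧
          SharpRecovery.IsSharpSolutionWith (SharpRecovery.analysisReg J₀ D) Φ x₀
            ((1 - (SharpRecovery.sourceCoefficient N D K v₀).toReal) * s * c₁)) ∧
    (LinearMap.ker Φ = ⊥ → ∀ c > (0 : ℝ),
      SharpRecovery.IsSharpSolutionWith (SharpRecovery.analysisReg J₀ D) Φ x₀ c) := by

  subst hS
  have hv₀K := intrinsicInterior_subset hv₀
  have hKc : IsCompact K := hK ▸ SharpRecovery.isCompact_subdifferential hcont _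
  have hKconv : Convex ℝ K := hK ▸ SharpRecovery.convex_subdifferential _ _
  have hball : ∃ s > (0 : ℝ), Metric.closedBall 0 s ∩
      (SharpRecovery.parallelSpace K : Set (EuclideanSpace ℝ (Fin p))) ⊆
        (fun v => v - v₀) '' K := by
    obtain ⟨s, hs, h⟩ := SharpRecovery.mem_intrinsicInterior_iff_exists_ball.1 hv₀
    exact ⟨s, hs, fun d hd => ⟨v₀ + d, h d hd.2 (by simpa using hd.1), by simp⟩⟩
  have htfae : List.TFAE [
      SharpRecovery.IsSharpSolution (SharpRecovery.analysisReg J₀ D) Φ x₀,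
      SharpRecovery.RestrictedInjectivity Φ D (SharpRecovery.parallelSpace K) ∧
        SharpRecovery.sourceCoefficient N D K v₀ < 1,
      SharpRecovery.RestrictedInjectivity Φ D (SharpRecovery.parallelSpace K) ∧
        SharpRecovery.NondegenerateSourceCondition Φ D K] := by
    tfae_have 1 → 3 := by
      rintro ⟨c, hc⟩
      subst hK
      exact ⟨SharpRecovery.restrictedInjectivity_of_isSharpSolutionWith hconv hcont hc,
        SharpRecovery.nondegenerateSourceCondition_of_isSharpSolutionWith hconv hcont hc hv₀⟩
    tfae_have 3 → 2 := fun ⟨hRI, h⟩ =>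
      ⟨hRI, SharpRecovery.sourceCoefficient_lt_one hKc hKconv hv₀K hRI hN h⟩
    tfae_have 2 → 1 := by
      rintro ⟨hRI, hρ⟩
      by_cases hΦ : LinearMap.ker Φ = ⊥
      · exact ⟨1, SharpRecovery.isSharpSolutionWith_of_ker_eq_bot _ hΦ one_pos⟩
      · obtain ⟨c₁, hc₁, hpos⟩ := SharpRecovery.exists_isLeast_norm_adjoint hRI hΦ
        obtain ⟨s, hs, hsC⟩ := hball
        exact ⟨_, SharpRecovery.isSharpSolutionWith_of_sourceCoefficient_lt_one hcont hK hv₀K hRI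
          hN hρ hc₁ hpos hs hsC⟩
    tfae_finish
  refine ⟨SharpRecovery.exists_sourceGauge_eq hKc hKconv hv₀K, htfae, hball, fun hsharp hΦ => ?_,
    fun hΦ c hc => SharpRecovery.isSharpSolutionWith_of_ker_eq_bot _ hΦ hc⟩
  obtain ⟨hRI, hρ⟩ := (htfae.out 0 1).1 hsharp
  obtain ⟨c₁, hc₁, hpos⟩ := SharpRecovery.exists_isLeast_norm_adjoint hRI hΦ
  refine ⟨c₁, hc₁, hpos, fun s hs hsC => ?_⟩
  have h := SharpRecovery.isSharpSolutionWith_of_sourceCoefficient_lt_one hcont hK hv₀K hRI hN hρ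
    hc₁ hpos hs hsC
  exact ⟨h.1, h⟩
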